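/- A parking preference of length $n$ is a sequence $(a_1,\dots,a_n)$ with entries in $\{1,\dots,n\}$. Cars $c_1,\dots,c_n$ enter, one after the other, a one-way street with spots $1,\dots,n$. Under the $1$-Naples rule, car $c_i$ parks in spot $a_i$ if it is free; otherwise it parks in spot $a_i-1$ if this spot exists and is free; otherwise it parks in the first free spot after $a_i$, and it fails to park if there is none. The preference is a $1$-Naples parking function if all cars park, and it is ascending if $a_1\le a_2\le\dots\le a_n$. Let $U_{n,1}$ be the number of ascending $1$-Naples parking functions of length $n$ with $a_1=1$ (so $U_{0,1}=0$, as the empty sequence has no first entry). Let $C(x)=\sum_{n\ge 0}C_n x^n$ be the generating function of the Catalan numbers $C_n=\frac{1}{n+1}\binom{2n}{n}$, and let the Fine numbers $F_0,F_1,F_2,\ldots = 1,0,1,2,6,18,57,\dots$ be defined by $$\sum_{n\ge 0}F_n x^n=\frac{1}{1-x^2C(x)^2}$$ (OEIS A000957 without its initial term $0$). Then for every $n\ge 0$, $$U_{n,1}=F_{n+1}.$$ -/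

import Mathlib

/-- The parking preferences of length `n`: sequences `(a_1, …, a_n)` with entries in `{1, …, n}`
(the entry `a_{i+1}` is `p i` for `i : Fin n`). -/
def parkingPreferences (n : ℕ) : Finset (Fin n → ℕ) :=
  Fintype.piFinset fun _ => Finset.Icc 1 n

/-- The spots that a car with preference `a` checks, in order, on a street with spots `1, …, n`
under the `k`-Naples rule: first `a, a - 1, …, a - k` (only those that are at least `1`; natural
subtraction sends the others to `0`, which is not a spot), and then `a + 1, a + 2, …, n`. -/
def naplesCandidates (n k a : ℕ) : List ℕ :=
  ((List.range (k + 1)).map fun j => a - j).filter (fun s => 1 ≤ s) ++ List.range' (a + 1) (n - a)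

/-- The spot in which a car with preference `a` parks when the spots in `occ` are taken:
the first free spot among those it checks, or `none` if it fails to park. -/
def naplesSpot (n k : ℕ) (occ : Finset ℕ) (a : ℕ) : Option ℕ :=
  (naplesCandidates n k a).find? (fun s => s ∉ occ)

/-- With the spots in `occ` already taken, do the cars with the listed preferences, arriving one
after the other, all succeed in parking under the `k`-Naples rule? -/
def naplesAllPark (n k : ℕ) : Finset ℕ → List ℕ → Bool
  | _, [] => true
  | occ, a :: as =>
    match naplesSpot n k occ a with
    | none => false
    | some s => naplesAllPark n k (insert s occ) as

/-- `p` is a `k`-Naples parking function of length `n`. -/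
def IsNaplesParkingFunction {n : ℕ} (k : ℕ) (p : Fin n → ℕ) : Prop :=
  p ∈ parkingPreferences n ∧ naplesAllPark n k ∅ (List.ofFn p) = true

/-- The number `U_{n,k}` of ascending (weakly increasing) `k`-Naples parking functions of length
`n` whose first entry is `1`. -/
noncomputable def numAscendingNaplesStartingWithOne (n k : ℕ) : ℕ :=
  open Classical in
  ((parkingPreferences n).filter fun p =>
    IsNaplesParkingFunction k p ∧ Monotone p ∧ ∃ h : 0 < n, p ⟨0, h⟩ = 1).card

/-- The generating function `C(x) = ∑ C_n x^n` of the Catalan numbers,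
with rational coefficients. -/
noncomputable def catalanGenFun : PowerSeries ℚ :=
  PowerSeries.map (Nat.castRingHom ℚ) PowerSeries.catalanSeries

/-- The generating function `F(x) = 1 / (1 - x² C(x)²)` of the Fine numbers
(the constant coefficient of the denominator is `1`, so this is a true inverse). -/
noncomputable def fineGenFun : PowerSeries ℚ :=
  (1 - PowerSeries.X ^ 2 * catalanGenFun ^ 2)⁻¹

/-- The Fine numbers `F_0, F_1, F_2, … = 1, 0, 1, 2, 6, 18, 57, …`. -/
noncomputable def fineNumber (n : ℕ) : ℚ :=
  PowerSeries.coeff n fineGenFun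

/-- The defining identity of the Fine generating function. -/
theorem fineGenFun_mul : fineGenFun * (1 - PowerSeries.X ^ 2 * catalanGenFun ^ 2) = 1 :=
  PowerSeries.inv_mul_cancel _ (by simp)

/-!
In an ascending preference the cars behave rigidly. Suppose the first `m` cars occupy exactly the
spots `1, …, m`, and all later preferences are at least `a`, where `a ≤ m + 1`. A next car that
prefers a spot `b ≤ m + 1` parks in `m + 1`. A next car that prefers `m + 2` leaves the hole
`m + 1`, which only a car with preference `m + 2` can still fill, so the car after it must also
prefer `m + 2`, and then exactly `1, …, m + 2` are taken. A preference beyond `m + 2` leaves the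
hole `m + 1` for good, and as there are as many cars as spots, some car then fails to park
(`card_add_length_lt_of_hole`).

So the number of ways to continue depends only on the number `r` of remaining cars and on the slack
`d = m + 1 - a`, and it satisfies the recursion of `completionCount` (`encard_completions`).
Its generating functions `G_d = ∑ completionCount r d * x ^ r` satisfy
`G_0 = 1 + x G_1 + x² G_1` and `G_{d+1} = G_d + x G_{d+2}`. These determine the `G_d`, and since
`C = 1 + x C²` and `F = 1 + x² C² F`, the solution is `G_d = C ^ (d + 1) F`
(`completionCount_eq_coeff`). After a first car with preference `1` the slack is `1`, so
`U_{n+1,1} = [x ^ n] C² F = [x ^ (n + 2)] F = F_{n+2}`.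
-/

/-! ### The parking rule -/

theorem bounds_of_mem_naplesCandidates {n k a s : ℕ} (han : a ≤ n)
    (hs : s ∈ naplesCandidates n k a) : 1 ≤ s ∧ s ≤ n ∧ a ≤ s + k := by
  simp only [naplesCandidates, List.mem_append, List.mem_filter, List.mem_map, List.mem_range,
    List.mem_range'_1, decide_eq_true_eq] at hs
  rcases hs with ⟨⟨j, hj, rfl⟩, h⟩ | h <;> omega

theorem naplesSpot_spec {n k a s : ℕ} {occ : Finset ℕ} (han : a ≤ n)
    (hs : naplesSpot n k occ a = some s) : s ∉ occ ∧ 1 ≤ s ∧ s ≤ n ∧ a ≤ s + k := by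
  refine ⟨?_, bounds_of_mem_naplesCandidates han (List.mem_of_find?_eq_some hs)⟩
  simpa using List.find?_some hs

/-- A hole that no remaining car can back into stays free, so that the cars cannot fill the
street. -/
theorem card_add_length_lt_of_hole {n k h : ℕ} (h1 : 1 ≤ h) (hn : h ≤ n) (L : List ℕ)
    (occ : Finset ℕ) (hocc : occ ⊆ Finset.Icc 1 n) (hh : h ∉ occ)
    (hL : ∀ b ∈ L, h + k < b ∧ b ≤ n) (hpark : naplesAllPark n k occ L = true) :
    occ.card + L.length < n := by
  induction L generalizing occ with
  | nil =>
    have : occ ⊂ Finset.Icc 1 n :=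
      (Finset.ssubset_iff_of_subset hocc).2 ⟨h, Finset.mem_Icc.2 ⟨h1, hn⟩, hh⟩
    simpa using Finset.card_lt_card this
  | cons b L ih =>
    rw [List.forall_mem_cons] at hL
    rw [naplesAllPark] at hpark
    split at hpark
    · simp at hpark
    · rename_i s hs
      obtain ⟨hs1, hs2, hs3, hs4⟩ := naplesSpot_spec hL.1.2 hs
      have := ih (insert s occ)
        (Finset.insert_subset (Finset.mem_Icc.2 ⟨hs2, hs3⟩) hocc)
        (by rw [Finset.mem_insert, not_or]; exact ⟨by omega, hh⟩) hL.2 hpark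
      rw [Finset.card_insert_of_notMem hs1] at this
      rw [List.length_cons]
      omega

theorem naplesCandidates_one {n a : ℕ} (ha : 1 ≤ a) :
    naplesCandidates n 1 a =
      a :: ((if 1 ≤ a - 1 then [a - 1] else []) ++ List.range' (a + 1) (n - a)) := by
  by_cases h : 1 ≤ a - 1 <;> simp [naplesCandidates, List.range_succ, h, ha]

theorem naplesSpot_of_notMem {n a : ℕ} {occ : Finset ℕ} (ha : 1 ≤ a) (h : a ∉ occ) :
    naplesSpot n 1 occ a = some a := by
  simp [naplesSpot, naplesCandidates_one ha, h]

theorem naplesSpot_Icc {n m b : ℕ} (hb : 1 ≤ b) (hbm : b ≤ m + 1) (hm : m < n) :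
    naplesSpot n 1 (Finset.Icc 1 m) b = some (m + 1) := by
  rcases Nat.lt_or_ge m b with h | h
  · obtain rfl : b = m + 1 := by omega
    exact naplesSpot_of_notMem hb (by simp)
  · have h1 : (List.range' (b + 1) (n - b)).find? (fun s => s ∉ Finset.Icc 1 m) =
        some (m + 1) := by
      rw [List.find?_range'_eq_some]
      refine ⟨by simp, List.mem_range'_1.2 (by omega), fun j hj hj' => ?_⟩
      simp only [Finset.mem_Icc, Bool.not_eq_true', decide_eq_false_iff_not, not_not]
      omega
    rw [naplesSpot, naplesCandidates_one hb, List.find?_cons_of_neg (by simp; omega),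
      List.find?_append, h1]
    split_ifs with h2
    · rw [List.find?_cons_of_neg (by simp; omega)]
      simp
    · simp

theorem naplesAllPark_cons_of_spot {n k a s : ℕ} {occ : Finset ℕ} {L : List ℕ}
    (h : naplesSpot n k occ a = some s) :
    naplesAllPark n k occ (a :: L) = naplesAllPark n k (insert s occ) L := by
  rw [naplesAllPark, h]

theorem insert_Icc_one (m : ℕ) : insert (m + 1) (Finset.Icc 1 m) = Finset.Icc 1 (m + 1) := by
  ext x
  simp only [Finset.mem_insert, Finset.mem_Icc]
  omega

theorem naplesAllPark_Icc_cons {n m b : ℕ} (hb : 1 ≤ b) (hbm : b ≤ m + 1) (hm : m < n)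
    (L : List ℕ) :
    naplesAllPark n 1 (Finset.Icc 1 m) (b :: L) = naplesAllPark n 1 (Finset.Icc 1 (m + 1)) L := by
  rw [naplesAllPark_cons_of_spot (naplesSpot_Icc hb hbm hm), insert_Icc_one]

/-- Two successive cars that both prefer `m + 2` take the spots `m + 2` and `m + 1`. -/
theorem naplesAllPark_Icc_cons_cons (n m : ℕ) (L : List ℕ) :
    naplesAllPark n 1 (Finset.Icc 1 m) ((m + 2) :: (m + 2) :: L) =
      naplesAllPark n 1 (Finset.Icc 1 (m + 2)) L := by
  have h : naplesSpot n 1 (insert (m + 2) (Finset.Icc 1 m)) (m + 2) = some (m + 1) := by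
    simp [naplesSpot, naplesCandidates_one]
  rw [naplesAllPark_cons_of_spot (naplesSpot_of_notMem (by omega) (by simp)),
    naplesAllPark_cons_of_spot h, Finset.insert_comm, insert_Icc_one, insert_Icc_one]

/-! ### Counting the ways to continue an ascending preference -/

/-- The ascending sequences of preferences, with entries between `a` and `n`, of the last `n - m`
cars for which all these cars park when exactly the spots `1, …, m` are already taken. The length
condition is written without subtraction, so there are none if `m > n`. -/
def completions (n m a : ℕ) : Set (List ℕ) :=
  {L | L.length + m = n ∧ L.Pairwise (· ≤ ·) ∧ (∀ b ∈ L, a ≤ b ∧ b ≤ n) ∧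
    naplesAllPark n 1 (Finset.Icc 1 m) L = true}

theorem completions_self (n a : ℕ) : completions n n a = {[]} := by
  ext L
  simp only [completions, Set.mem_ofPred_eq, Set.mem_singleton_iff]
  constructor
  · rintro ⟨h, -⟩
    exact List.length_eq_zero_iff.1 (by omega)
  · rintro rfl
    simp [naplesAllPark]

theorem cons_mem_completions {n m a b : ℕ} (ha : 1 ≤ a) (hab : a ≤ b) (hb : b ≤ m + 1)
    (hm : m < n) (L : List ℕ) : b :: L ∈ completions n m a ↔ L ∈ completions n (m + 1) b := by
  simp only [completions, Set.mem_ofPred_eq, List.length_cons, List.pairwise_cons,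
    List.forall_mem_cons, naplesAllPark_Icc_cons (ha.trans hab) hb hm]
  constructor
  · rintro ⟨h1, ⟨h2, h3⟩, ⟨-, h4⟩, h5⟩
    exact ⟨by omega, h3, fun c hc => ⟨h2 c hc, (h4 c hc).2⟩, h5⟩
  · rintro ⟨h1, h2, h3, h4⟩
    exact ⟨by omega, ⟨fun c hc => (h3 c hc).1, h2⟩,
      ⟨⟨hab, by omega⟩, fun c hc => ⟨hab.trans (h3 c hc).1, (h3 c hc).2⟩⟩, h4⟩

theorem cons_cons_mem_completions {n m a : ℕ} (ham : a ≤ m + 1) (L : List ℕ) :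
    (m + 2) :: (m + 2) :: L ∈ completions n m a ↔ L ∈ completions n (m + 2) (m + 2) := by
  simp only [completions, Set.mem_ofPred_eq, List.length_cons, List.pairwise_cons,
    List.forall_mem_cons, naplesAllPark_Icc_cons_cons]
  constructor
  · rintro ⟨h1, ⟨-, h2, h3⟩, ⟨-, -, h4⟩, h5⟩
    exact ⟨by omega, h3, fun c hc => ⟨h2 c hc, (h4 c hc).2⟩, h5⟩
  · rintro ⟨h1, h2, h3, h4⟩
    have h5 : ∀ c ∈ L, m + 2 ≤ c := fun c hc => (h3 c hc).1
    exact ⟨by omega, ⟨⟨le_rfl, h5⟩, h5, h2⟩, ⟨⟨by omega, by omega⟩, ⟨by omega, by omega⟩,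
      fun c hc => ⟨by have := h5 c hc; omega, (h3 c hc).2⟩⟩, h4⟩

/-- A car that skips the first free spot `m + 1` must prefer `m + 2`, and the next car must too. -/
theorem eq_cons_cons_of_mem_completions {n m a b : ℕ} {L : List ℕ} (hb : m + 1 < b)
    (h : b :: L ∈ completions n m a) : ∃ L', b :: L = (m + 2) :: (m + 2) :: L' := by
  obtain ⟨hlen, hsort, hbd, hpark⟩ := h
  have hbn := (hbd b List.mem_cons_self).2
  have hge := (List.pairwise_cons.1 hsort).1
  obtain rfl : b = m + 2 := by
    by_contra hne
    have := card_add_length_lt_of_hole (h := m + 1) (by omega) (by omega) (b :: L) _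
      (Finset.Icc_subset_Icc_right (by omega)) (by simp)
      (fun c hc => ⟨?_, (hbd c hc).2⟩) hpark
    · rw [Nat.card_Icc] at this
      omega
    · rcases List.mem_cons.1 hc with rfl | hc
      · omega
      · have := hge c hc
        omega
  have hhead : m + 2 ∈ L := by
    by_contra hnot
    rw [naplesAllPark_cons_of_spot (naplesSpot_of_notMem (by omega) (by simp))] at hpark
    have := card_add_length_lt_of_hole (h := m + 1) (by omega) (by omega) L _
      (Finset.insert_subset (Finset.mem_Icc.2 ⟨by omega, hbn⟩)
        (Finset.Icc_subset_Icc_right (by omega))) (by simp)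
      (fun c hc => ⟨?_, (hbd c (List.mem_cons_of_mem _ hc)).2⟩) hpark
    · rw [Finset.card_insert_of_notMem (by simp), Nat.card_Icc] at this
      rw [List.length_cons] at hlen
      omega
    · have h1 := hge c hc
      have h2 : c ≠ m + 2 := fun h => hnot (h ▸ hc)
      omega
  cases L with
  | nil => simp at hhead
  | cons c L =>
    refine ⟨L, ?_⟩
    have h1 := hge c List.mem_cons_self
    rcases List.mem_cons.1 hhead with h2 | h2
    · rw [← h2]
    · have h3 := (List.pairwise_cons.1 (List.pairwise_cons.1 hsort).2).1 _ h2
      rw [le_antisymm h3 h1]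

/-- As the preferences ascend, either the first one is `a`, or all of them are at least `a + 1`. -/
theorem completions_eq_union {n m a : ℕ} (ha : 1 ≤ a) (ham : a ≤ m) (hm : m < n) :
    completions n m a = completions n m (a + 1) ∪ List.cons a '' completions n (m + 1) a := by
  ext L
  rw [Set.mem_union, Set.mem_image]
  constructor
  · intro h
    cases L with
    | nil => exact absurd h.1 (by simp; omega)
    | cons b L =>
      rcases eq_or_lt_of_le (h.2.2.1 b List.mem_cons_self).1 with rfl | hlt
      · exact Or.inr ⟨L, (cons_mem_completions ha le_rfl (by omega) hm L).1 h, rfl⟩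
      · refine Or.inl ⟨h.1, h.2.1, fun c hc => ⟨?_, (h.2.2.1 c hc).2⟩, h.2.2.2⟩
        rcases List.mem_cons.1 hc with rfl | hc
        · exact hlt
        · exact hlt.trans_le ((List.pairwise_cons.1 h.2.1).1 c hc)
  · rintro (h | ⟨L, h, rfl⟩)
    · exact ⟨h.1, h.2.1, fun c hc => ⟨(Nat.le_succ a).trans (h.2.2.1 c hc).1, (h.2.2.1 c hc).2⟩,
        h.2.2.2⟩
    · exact (cons_mem_completions ha le_rfl (by omega) hm L).2 h

theorem completions_succ_eq_union {n m : ℕ} (hm : m < n) :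
    completions n m (m + 1) = List.cons (m + 1) '' completions n (m + 1) (m + 1) ∪
      (fun L => (m + 2) :: (m + 2) :: L) '' completions n (m + 2) (m + 2) := by
  ext L
  rw [Set.mem_union, Set.mem_image, Set.mem_image]
  constructor
  · intro h
    cases L with
    | nil => exact absurd h.1 (by simp; omega)
    | cons b L =>
      rcases eq_or_lt_of_le (h.2.2.1 b List.mem_cons_self).1 with rfl | hlt
      · exact Or.inl ⟨L, (cons_mem_completions (by omega) le_rfl le_rfl hm L).1 h, rfl⟩
      · obtain ⟨L', hL'⟩ := eq_cons_cons_of_mem_completions hlt h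
        rw [hL'] at h ⊢
        exact Or.inr ⟨L', (cons_cons_mem_completions le_rfl L').1 h, rfl⟩
  · rintro (⟨L, h, rfl⟩ | ⟨L, h, rfl⟩)
    · exact (cons_mem_completions (by omega) le_rfl le_rfl hm L).2 h
    · exact (cons_cons_mem_completions le_rfl L).2 h

/-- The number of ways to continue with `r` more cars when the spots `1, …, m` are taken and later
preferences are at least `m + 1 - d`. It does not depend on `m`. For `r > 0` and `d = 0`, the next
car either prefers `m + 1`, or it and its successor both prefer `m + 2`, which needs `r ≥ 2`; for
`d > 0`, the next preference is either more than `m + 1 - d` or equal to it. -/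
def completionCount : ℕ → ℕ → ℕ
  | 0, _ => 1
  | 1, 0 => completionCount 0 1
  | r + 2, 0 => completionCount (r + 1) 1 + completionCount r 1
  | r + 1, d + 1 => completionCount (r + 1) d + completionCount r (d + 2)
termination_by r d => (r, d)

theorem encard_completions {r d n m a : ℕ} (hr : m + r = n) (ha : 1 ≤ a) (hd : a + d = m + 1) :
    (completions n m a).encard = completionCount r d := by
  induction r, d using completionCount.induct generalizing m a with
  | case1 d =>
    obtain rfl : m = n := hr
    simp [completions_self, completionCount]
  | case2 ih =>
    obtain rfl : a = m + 1 := hd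
    subst hr
    -- With one car left a pair of cars preferring `m + 2` is impossible.
    have hempty : completions (m + 1) (m + 2) (m + 2) = ∅ :=
      Set.eq_empty_of_forall_notMem fun L h => by have := h.1; omega
    rw [completions_succ_eq_union (by omega), hempty, Set.image_empty, Set.union_empty,
      List.cons_injective.encard_image, ih rfl ha rfl]
    simp [completionCount]
  | case3 r ih1 ih2 =>
    obtain rfl : a = m + 1 := hd
    have hinj : Function.Injective fun L : List ℕ => (m + 2) :: (m + 2) :: L :=
      List.cons_injective.comp List.cons_injective
    rw [completions_succ_eq_union (by omega), Set.encard_union_eq, List.cons_injective.encard_image,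
      hinj.encard_image, ih1 (by omega) (by omega) (by omega),
      ih2 (by omega) (by omega) (by omega), completionCount, Nat.cast_add]
    rw [Set.disjoint_left]
    rintro _ ⟨L, -, rfl⟩ ⟨L', -, h⟩
    have := List.head_eq_of_cons_eq h
    omega
  | case4 r d ih1 ih2 =>
    rw [completions_eq_union ha (by omega) (by omega), Set.encard_union_eq,
      List.cons_injective.encard_image, ih1 (by omega) (by omega) (by omega),
      ih2 (by omega) (by omega) (by omega), completionCount, Nat.cast_add]
    rw [Set.disjoint_left]
    rintro _ h ⟨L, -, rfl⟩
    have := (h.2.2.1 a List.mem_cons_self).1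
    omega

theorem numAscendingNaplesStartingWithOne_succ (n : ℕ) :
    numAscendingNaplesStartingWithOne (n + 1) 1 = completionCount n 1 := by
  classical
  have hset : ((Finset.filter (fun p => IsNaplesParkingFunction 1 p ∧ Monotone p ∧
        ∃ h : 0 < n + 1, p ⟨0, h⟩ = 1) (parkingPreferences (n + 1)) : Finset _) :
        Set (Fin (n + 1) → ℕ)) =
      List.ofFn ⁻¹' (List.cons 1 '' completions (n + 1) 1 1) := by
    ext p
    have hcons (L : List ℕ) : L ∈ completions (n + 1) 1 1 ↔ 1 :: L ∈ completions (n + 1) 0 1 :=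
      (cons_mem_completions le_rfl le_rfl le_rfl (by omega) L).symm
    have hmem : List.ofFn p ∈ completions (n + 1) 0 1 ↔
        Monotone p ∧ IsNaplesParkingFunction 1 p := by
      rw [← List.sortedLE_ofFn_iff, List.sortedLE_iff_pairwise]
      simp only [completions, IsNaplesParkingFunction, parkingPreferences, Fintype.mem_piFinset,
        Set.mem_ofPred_eq, List.length_ofFn, List.forall_mem_ofFn_iff, Finset.mem_Icc, add_zero,
        true_and, Finset.Icc_eq_empty_of_lt Nat.zero_lt_one]
    have himage : List.ofFn p ∈ List.cons 1 '' completions (n + 1) 1 1 ↔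
        List.ofFn p ∈ completions (n + 1) 0 1 ∧ p 0 = 1 := by
      rw [List.ofFn_succ]
      constructor
      · rintro ⟨L, hL, h⟩
        rw [← h]
        exact ⟨(hcons L).1 hL, (List.head_eq_of_cons_eq h).symm⟩
      · rintro ⟨h, h1⟩
        rw [h1] at h ⊢
        exact ⟨_, (hcons _).2 h, rfl⟩
    rw [Set.mem_preimage, himage, hmem, Finset.mem_coe, Finset.mem_filter]
    constructor
    · rintro ⟨-, h1, h2, ⟨_, h3⟩⟩
      exact ⟨⟨h2, h1⟩, h3⟩
    · rintro ⟨⟨h2, h1⟩, h3⟩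
      exact ⟨h1.1, h1, h2, Nat.succ_pos n, h3⟩
  have hrange : List.cons 1 '' completions (n + 1) 1 1 ⊆
      Set.range (List.ofFn : (Fin (n + 1) → ℕ) → List ℕ) := by
    rintro _ ⟨L, hL, rfl⟩
    have hlen : (1 :: L).length = n + 1 := hL.1
    rw [← hlen]
    exact ⟨(1 :: L).get, List.ofFn_get _⟩
  have h := Set.encard_preimage_of_injective_subset_range
    (List.ofFn_injective (α := ℕ) (n := n + 1)) hrange
  rw [← hset, Set.encard_coe_eq_coe_finsetCard, List.cons_injective.encard_image,
    encard_completions (r := n) (d := 1) (by omega) le_rfl rfl] at h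
  rw [numAscendingNaplesStartingWithOne]
  exact_mod_cast h

/-! ### Generating functions -/

open PowerSeries in
theorem catalanGenFun_eq : catalanGenFun = 1 + X * catalanGenFun ^ 2 := by
  have h := congrArg (PowerSeries.map (Nat.castRingHom ℚ)) catalanSeries_sq_mul_X_add_one
  simp only [map_add, map_mul, map_pow, map_one, PowerSeries.map_X] at h
  rw [← catalanGenFun] at h
  linear_combination -h

open PowerSeries in
theorem fineGenFun_eq : fineGenFun = 1 + X ^ 2 * (catalanGenFun ^ 2 * fineGenFun) := by
  linear_combination fineGenFun_mul

open PowerSeries in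
theorem catalanGenFun_mul_fineGenFun :
    catalanGenFun * fineGenFun =
      1 + X * (catalanGenFun ^ 2 * fineGenFun) + X ^ 2 * (catalanGenFun ^ 2 * fineGenFun) := by
  linear_combination fineGenFun * catalanGenFun_eq + fineGenFun_eq

open PowerSeries in
theorem catalanGenFun_pow_mul_fineGenFun (d : ℕ) :
    catalanGenFun ^ (d + 2) * fineGenFun =
      catalanGenFun ^ (d + 1) * fineGenFun + X * (catalanGenFun ^ (d + 3) * fineGenFun) := by
  linear_combination catalanGenFun ^ (d + 1) * fineGenFun * catalanGenFun_eq

open PowerSeries in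
theorem completionCount_eq_coeff (r d : ℕ) :
    (completionCount r d : ℚ) = coeff r (catalanGenFun ^ (d + 1) * fineGenFun) := by
  induction r, d using completionCount.induct with
  | case1 d =>
    have h : constantCoeff catalanGenFun = 1 := by rw [catalanGenFun_eq]; simp
    simp [completionCount, h, fineGenFun]
  | case2 ih =>
    rw [completionCount, ih, zero_add, pow_one, catalanGenFun_mul_fineGenFun]
    simp [coeff_one, coeff_X_pow_mul', coeff_succ_X_mul 0]
  | case3 r ih1 ih2 =>
    rw [completionCount, Nat.cast_add, ih1, ih2, zero_add, pow_one, catalanGenFun_mul_fineGenFun]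
    rw [map_add, map_add, show r.succ.succ = r + 2 from rfl, coeff_X_pow_mul,
      show r + 2 = r + 1 + 1 from rfl, coeff_succ_X_mul]
    simp [coeff_one]
  | case4 r d ih1 ih2 =>
    rw [completionCount, Nat.cast_add, ih1, ih2, catalanGenFun_pow_mul_fineGenFun d, map_add,
      coeff_succ_X_mul]

theorem theorem5p3 (n : ℕ) :
    (numAscendingNaplesStartingWithOne n 1 : ℚ) = fineNumber (n + 1) := by
  rw [fineNumber, fineGenFun_eq, map_add]
  cases n with
  | zero =>
    simp [numAscendingNaplesStartingWithOne, PowerSeries.coeff_one, PowerSeries.coeff_X_pow_mul']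
  | succ n =>
    rw [numAscendingNaplesStartingWithOne_succ, completionCount_eq_coeff,
      show n + 1 + 1 = n + 2 from rfl, PowerSeries.coeff_X_pow_mul]
    simp [PowerSeries.coeff_one]
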